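/- The variety $\mathbf{var}\,H$ generated by a group $H$ is the class of all groups satisfying every identity (law) of $H$. A subgroup $H$ of a group $G$ is a retract of $G$ if $H$ is the image of an endomorphism $\rho$ of $G$ with $\rho\circ\rho=\rho$. A group $H$ is a strong retract if $H$ is a retract of every group $G\supseteq H$ with $G\in\mathbf{var}\,H$. A subgroup $H$ of a group $G$ is verbally closed in $G$ if every equation $w(x,y,\dots)=h$, where $w$ is an element of a free group $F(x,y,\dots)$ and $h\in H$, having a solution in $G$ has a solution in $H$. It is algebraically closed in $G$ if every finite system of equations $w_1(x,y,\dots)=1,\dots,w_m(x,y,\dots)=1$ with $w_i\in H*F(x,y,\dots)$ having a solution in $G$ has a solution in $H$. A group $H$ is strongly verbally closed if it is algebraically closed in every group containing $H$ as a verbally closed subgroup. Theorem. Every symmetric group and every alternating group on a finite set is a strong retract, and is strongly verbally closed. -/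

import Mathlib

universe u v

/-- The word `w` is a law (identity) of the group `G`: it takes the value `1` under every
substitution of elements of `G` for the letters. A word involves only finitely many letters, so
countably many letters suffice. -/
def IsGroupLaw (w : FreeGroup ℕ) (G : Type u) [Group G] : Prop :=
  ∀ g : ℕ → G, FreeGroup.lift g w = 1

/-- `G` lies in the variety `var H` generated by `H`: every law of `H` is a law of `G`. -/
def InVarietyOf (H : Type u) [Group H] (G : Type v) [Group G] : Prop :=
  ∀ w : FreeGroup ℕ, IsGroupLaw w H → IsGroupLaw w G

/-- The subgroup `K` is a retract of `G`: it is the image of an idempotent endomorphism. -/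
def IsGroupRetract {G : Type u} [Group G] (K : Subgroup G) : Prop :=
  ∃ ρ : G →* G, ρ.comp ρ = ρ ∧ ρ.range = K

/-- The subgroup `K` is verbally closed in `G`: each equation `w(x₀, x₁, …) = h` with `w` an
element of a free group and `h ∈ K` that has a solution in `G` has a solution in `K`. -/
def IsVerballyClosed {G : Type u} [Group G] (K : Subgroup G) : Prop :=
  ∀ (w : FreeGroup ℕ) (h : K),
    (∃ g : ℕ → G, FreeGroup.lift g w = (h : G)) → ∃ k : ℕ → K, FreeGroup.lift k w = h

/-- The subgroup `K` is algebraically closed in `G`: each finite system of equations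
`{w = 1 | w ∈ S}`, with `S` a finite subset of the free product `K * F(x₀, x₁, …)`, that has a
solution in `G` has a solution in `K`. -/
def IsAlgebraicallyClosedSubgroup {G : Type u} [Group G] (K : Subgroup G) : Prop :=
  ∀ S : Finset (Monoid.Coprod K (FreeGroup ℕ)),
    (∃ g : ℕ → G, ∀ w ∈ S, Monoid.Coprod.lift K.subtype (FreeGroup.lift g) w = 1) →
      ∃ k : ℕ → K, ∀ w ∈ S, Monoid.Coprod.lift (MonoidHom.id K) (FreeGroup.lift k) w = 1

/-- `H` is a strong retract: for every group `G` in `var H` (in the universe `v`) and every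
embedding of `H` into `G`, the copy of `H` in `G` is a retract of `G`. -/
def IsStrongRetract (H : Type u) [Group H] : Prop :=
  ∀ (G : Type v) [Group G] (ι : H →* G), Function.Injective ι → InVarietyOf H G →
    IsGroupRetract ι.range

/-- `H` is strongly verbally closed: for every group `G` (in the universe `v`) and every embedding
of `H` into `G` as a verbally closed subgroup, the copy of `H` is algebraically closed in `G`. -/
def IsStronglyVerballyClosed (H : Type u) [Group H] : Prop :=
  ∀ (G : Type v) [Group G] (ι : H →* G), Function.Injective ι → IsVerballyClosed ι.range →
    IsAlgebraicallyClosedSubgroup ι.range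

/-!
Call a finite group `H` tight if it has a smallest nontrivial normal subgroup `M` and satisfies a
condition on its sections (`HasTightMonolith`) that holds for instance if the centralizer `Z` of `M`
is trivial, or has prime order, or has order four while `H` has trivial center. Every nontrivial
symmetric or alternating group is tight: from degree five on, `M` is the alternating group and `Z`
is trivial; in degree four, `M` is the Klein four-group and `Z = M`; in smaller degrees, `Z` has
order two or three.

A tight group `H` is a strong retract. For a group `G ⊇ H` in the variety of `H`, an ultrafilter
limit of retractions (`exists_retraction_of_finset`) reduces the problem to a finitely generated
`G`. Such a `G` is a quotient `F ⧸ N` of a free group in which finitely many kernels `K i` of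
homomorphisms `F →* H` intersect inside `N`. Dividing by a normal subgroup of `G` that is maximal
subject to meeting `H` trivially, one may assume that each nontrivial normal subgroup of `G` meets
`H` nontrivially, hence contains `M` and its normal closure `μ`. The claim is then `G = H`
(`HasTightMonolith.surjective_of_essential`), and it is enough to show `|G| ≤ |H|`.

Choose a minimal set `J` of indices with `⨅ i ∈ J, K i ≤ N`, and let `C ≤ F` be the preimage of the
centralizer of `μ`. By minimality the intersection of the `K j` with `j ≠ i` covers `μ`, and it
commutes with `K i` modulo `N`; so `K i ≤ C` for `i ∈ J`. The group `H ⧸ Z` embeds into `F ⧸ C`, so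
tightness says that `C ⧸ K i`, a normal subgroup of the image of `F` in `H`, is trivial or minimal
normal there. Hence `C` is semisimple as an `F`-group modulo the intersection of the `K i`
(`exists_normal_supplement`). A supplement of the preimage of `μ` in `C` is trivial in `G`, so
either `C = N` or `C ⧸ N = μ`; in both cases `C ⧸ N` is no larger than some `C ⧸ K i`, which gives
`|G| ≤ |F ⧸ K i| ≤ |H|` (`exists_index_le_index`).

Finally, a strong retract `H` is strongly verbally closed: if `H` is verbally closed in `G`, it
meets trivially the verbal subgroup of `G` given by the laws of `H`, so it embeds into a quotient of
`G` in the variety of `H`. A retraction of that quotient onto `H` yields one of `G`, which carries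
solutions of equations over `H` in `G` to solutions in `H`.
-/

universe w

open scoped commutatorElement

/-! ### Normal subgroups of a subdirect product -/

/-- A semisimplicity statement for normal subgroups below `C`: if the image of `C` modulo each `K i`
is trivial or minimal normal, then each normal subgroup `A` has a normal supplement `X` in `C` that
meets `A` only inside `⨅ i ∈ J, K i`. -/
theorem exists_normal_supplement {F I : Type*} [Group F] (J : Finset I) (K : I → Subgroup F)
    [∀ i, (K i).Normal] (A C : Subgroup F) [A.Normal] [C.Normal]
    (hmax : ∀ i ∈ J, ∀ Y : Subgroup F, Y.Normal → Y ≤ C → Y ≤ K i ∨ C ≤ Y ⊔ K i) :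
    ∃ X : Subgroup F, X.Normal ∧ X ≤ C ∧ C ≤ A ⊔ X ∧ ∀ i ∈ J, X ⊓ A ≤ K i := by
  classical
  induction J using Finset.induction_on with
  | empty => exact ⟨C, inferInstance, le_rfl, le_sup_right, by simp⟩
  | insert i J _ ih =>
    obtain ⟨X, hX, hXC, hCX, hXA⟩ := ih fun j hj => hmax j (Finset.mem_insert_of_mem hj)
    rcases hmax i (Finset.mem_insert_self i J) (X ⊓ A) inferInstance (inf_le_left.trans hXC)
      with h | h
    · refine ⟨X, hX, hXC, hCX, fun j hj => ?_⟩
      rcases Finset.mem_insert.1 hj with rfl | hj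
      exacts [h, hXA j hj]
    · refine ⟨X ⊓ K i, inferInstance, inf_le_left.trans hXC, fun c hc => ?_, fun j hj => ?_⟩
      -- the modular law: `X = (X ⊓ A) ⊔ (X ⊓ K i)`
      · obtain ⟨a, ha, x, hx, rfl⟩ := Subgroup.mem_sup_of_normal_right.1 (hCX hc)
        obtain ⟨y, hy, k, hk, rfl⟩ := Subgroup.mem_sup_of_normal_right.1 (h (hXC hx))
        refine Subgroup.mem_sup_of_normal_right.2
          ⟨a * y, A.mul_mem ha hy.2, k, ⟨?_, hk⟩, mul_assoc _ _ _⟩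
        simpa using X.mul_mem (X.inv_mem hy.1) hx
      · rcases Finset.mem_insert.1 hj with rfl | hj
        · exact inf_le_left.trans inf_le_right
        · exact (inf_le_inf_right A inf_le_left).trans (hXA j hj)

/-- The order estimate behind the theorem, for a group `F ⧸ N` presented as a quotient of a
subdirect product with coordinate kernels `K i`. Here `A ⧸ N` lies in each nontrivial normal
subgroup of `F ⧸ N`, and `C ⧸ K i` is trivial or minimal normal for `i ∈ J`. Semisimplicity makes
`C ⧸ N` trivial or equal to `A ⧸ N`, and in the latter case no larger than some `C ⧸ K i`. -/
theorem exists_index_le_index {F I : Type*} [Group F] (J : Finset I) (K : I → Subgroup F)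
    [∀ i, (K i).Normal] (N A C : Subgroup F) [N.Normal] [A.Normal] [C.Normal]
    (hNA : N ≤ A) (hAN : ¬ A ≤ N) (hNC : N ≤ C)
    (hess : ∀ X : Subgroup F, X.Normal → X ≤ N ∨ A ≤ X ⊔ N)
    (hJ : ⨅ i ∈ J, K i ≤ N) (hKC : ∀ i ∈ J, K i ≤ C) (hfin : ∀ i, (K i).index ≠ 0)
    (hmax : ∀ i ∈ J, ∀ Y : Subgroup F, Y.Normal → Y ≤ C → Y ≤ K i ∨ C ≤ Y ⊔ K i) :
    ∃ i ∈ J, N.index ≠ 0 ∧ N.index ≤ (K i).index := by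
  classical
  by_cases hCN : C ≤ N
  · obtain ⟨i, hi⟩ : J.Nonempty := by
      rw [Finset.nonempty_iff_ne_empty]
      rintro rfl
      exact hAN (le_top.trans (by simpa using hJ))
    have h := Subgroup.index_dvd_of_le ((hKC i hi).trans hCN)
    exact ⟨i, hi, fun h0 => hfin i (by simpa [h0] using h),
      Nat.le_of_dvd (Nat.pos_of_ne_zero (hfin i)) h⟩
  have hAC : A ≤ C := (hess C inferInstance).resolve_left hCN |>.trans (sup_le le_rfl hNC)
  -- a supplement of `A` in `C` is trivial modulo `N`, so `C = A`
  have hCA : C ≤ A := by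
    obtain ⟨X, hX, hXC, hCX, hXA⟩ := exists_normal_supplement J K A C hmax
    have hXAN : X ⊓ A ≤ N := le_trans (le_iInf₂ hXA) hJ
    rcases hess X hX with h | h
    · exact hCX.trans (sup_le le_rfl (h.trans hNA))
    · refine absurd (fun a ha => ?_) hAN
      obtain ⟨x, hx, n, hn, rfl⟩ := Subgroup.mem_sup_of_normal_right.1 (h ha)
      refine N.mul_mem (hXAN ⟨hx, ?_⟩) hn
      simpa using A.mul_mem ha (A.inv_mem (hNA hn))
  -- `C = A` is minimal normal modulo `N`; realize `C ⧸ N` by a supplement `X` of `N`, and cut `X`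
  -- down to a `Y` that still covers `C ⧸ N` while `Y ⊓ K i = Y ⊓ N`
  obtain ⟨X, hX, hXC, hCX, hXN⟩ := exists_normal_supplement J K N C hmax
  have hinf (S : Finset I) : (⨅ i ∈ S, K i).Normal :=
    Subgroup.normal_iInf_normal fun i => Subgroup.normal_iInf_normal fun _ => inferInstance
  obtain ⟨S, hSJ, hS⟩ := exists_minimal_le_of_wellFoundedLT
    (fun S : Finset I => X ⊓ ⨅ i ∈ S, K i ≤ N) J (inf_le_right.trans hJ)
  obtain ⟨i, hi⟩ : S.Nonempty := by
    rw [Finset.nonempty_iff_ne_empty]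
    rintro rfl
    exact hCN (hCX.trans (sup_le le_rfl (by simpa using hS.prop)))
  have hiJ : i ∈ J := hSJ hi
  have := hinf (S.erase i)
  set Y := X ⊓ ⨅ j ∈ S.erase i, K j
  have hYN : ¬ Y ≤ N := fun h =>
    Finset.notMem_erase i S (hS.le_of_le h (Finset.erase_subset i S) hi)
  have hYC : Y ≤ C := inf_le_left.trans hXC
  have hYNC : Y ⊔ N = C :=
    le_antisymm (sup_le hYC hNC) (hCA.trans ((hess Y inferInstance).resolve_left hYN))
  have hinfeq : N ⊓ Y = K i ⊓ Y := by
    refine le_antisymm (le_inf (fun x hx => hXN i hiJ ⟨hx.2.1, hx.1⟩) inf_le_right)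
      (le_inf (fun x hx => hS.prop (Subgroup.mem_inf.2 ⟨hx.2.1, ?_⟩)) inf_le_right)
    have h2 : x ∈ ⨅ j ∈ S.erase i, K j := hx.2.2
    simp only [Subgroup.mem_iInf, Finset.mem_erase] at h2 ⊢
    intro j hj
    by_cases hji : j = i
    exacts [hji ▸ hx.1, h2 j ⟨hji, hj⟩]
  have hrel : N.relIndex C ∣ (K i).relIndex C := by
    rw [← hYNC, Subgroup.relIndex_sup_right, ← Subgroup.inf_relIndex_right, hinfeq,
      Subgroup.inf_relIndex_right, hYNC]
    have : (K i).relIndex Y = (K i).relIndex (Y ⊔ K i) := (Subgroup.relIndex_sup_right ..).symm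
    rw [this, ← Subgroup.relIndex_mul_relIndex (K i) (Y ⊔ K i) C le_sup_right
      (sup_le hYC (hKC i hiJ))]
    exact dvd_mul_right _ _
  have hdvd : N.index ∣ (K i).index := by
    rw [← Subgroup.relIndex_mul_index hNC, ← Subgroup.relIndex_mul_index (hKC i hiJ)]
    exact mul_dvd_mul_right hrel _
  exact ⟨i, hiJ, fun h0 => hfin i (by simpa [h0] using hdvd),
    Nat.le_of_dvd (Nat.pos_of_ne_zero (hfin i)) hdvd⟩

/-! ### Groups with a tight monolith -/

/-- A group `H` has a tight monolith if it has a smallest nontrivial normal subgroup `M` and, for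
the centralizer `Z` of `M`, each section `P ⧸ Q` of `H` whose order is divisible by that of `H ⧸ Z`
has a kernel `Q` that contains no normal subgroup of `P` other than `⊥` and `Q`. -/
def HasTightMonolith (H : Type*) [Group H] : Prop :=
  ∃ M : Subgroup H, M ≠ ⊥ ∧ (∀ X : Subgroup H, X.Normal → X ≠ ⊥ → M ≤ X) ∧
    ∀ P Q R : Subgroup H, R ≤ Q → Q ≤ P →
      (∀ g ∈ P, ∀ x ∈ Q, g * x * g⁻¹ ∈ Q) → (∀ g ∈ P, ∀ x ∈ R, g * x * g⁻¹ ∈ R) →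
      (Subgroup.centralizer (M : Set H)).index ∣ Q.relIndex P → R = ⊥ ∨ R = Q

/-- A group with a tight monolith has no proper essential extension among the quotients of
subdirect products of finitely many of its subgroups. -/
theorem HasTightMonolith.surjective_of_essential {F G H I : Type*} [Group F] [Group G] [Group H]
    [Finite H] [Finite I] (hH : HasTightMonolith H) (p : I → F →* H) (π : F →* G)
    (hπ : Function.Surjective π) (hker : ⨅ i, (p i).ker ≤ π.ker) (ι : H →* G)
    (hι : Function.Injective ι)
    (hess : ∀ X : Subgroup G, X.Normal → X ≠ ⊥ → X ⊓ ι.range ≠ ⊥) : Function.Surjective ι := by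
  classical
  obtain ⟨M, hM, hmono, hsec⟩ := hH
  have := Fintype.ofFinite I
  -- each nontrivial normal subgroup of `G` contains the copy of `M`
  have hMle (X : Subgroup G) (hX : X.Normal) (hne : X ≠ ⊥) : M.map ι ≤ X := by
    rw [Subgroup.map_le_iff_le_comap]
    refine hmono _ (hX.comap ι) fun h => hess X hX hne ?_
    rw [eq_bot_iff]
    rintro _ ⟨hx, y, rfl⟩
    have : y ∈ X.comap ι := hx
    rw [h, Subgroup.mem_bot] at this
    simp [this]
  set μ := Subgroup.normalClosure (M.map ι : Set G)
  have hμle (X : Subgroup G) (hX : X.Normal) (hne : X ≠ ⊥) : μ ≤ X :=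
    Subgroup.normalClosure_le_normal (hMle X hX hne)
  have hMμ : M.map ι ≤ μ := Subgroup.subset_normalClosure
  have hμbot : μ ≠ ⊥ := fun h => hM ((Subgroup.map_eq_bot_iff_of_injective M hι).1
    (le_bot_iff.1 (h ▸ hMμ)))
  set D := Subgroup.centralizer (μ : Set G) with hD
  have hker_map (X : Subgroup F) (hX : X.Normal) : X ≤ π.ker ∨ μ ≤ X.map π := by
    by_cases h : X.map π = ⊥
    · exact Or.inl ((Subgroup.map_eq_bot_iff X).1 h)
    · exact Or.inr (hμle _ (hX.map π hπ) h)
  obtain ⟨J, -, hJ⟩ := exists_minimal_le_of_wellFoundedLT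
    (fun J : Finset I => ⨅ i ∈ J, (p i).ker ≤ π.ker) Finset.univ (by simpa using hker)
  -- `K i` and the intersection of the other kernels commute modulo `π.ker`
  have hKC (i : I) (hi : i ∈ J) : (p i).ker ≤ D.comap π := by
    have hR : (⨅ j ∈ J.erase i, (p j).ker).Normal :=
      Subgroup.normal_iInf_normal fun j => Subgroup.normal_iInf_normal fun _ => inferInstance
    have hle := (hker_map _ hR).resolve_left fun h =>
      Finset.notMem_erase i J (hJ.le_of_le h (Finset.erase_subset i J) hi)
    intro k hk
    rw [Subgroup.mem_comap, hD, Subgroup.mem_centralizer_iff]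
    intro a ha
    obtain ⟨r, hr, rfl⟩ := hle ha
    have hcomm : ⁅r, k⁆ ∈ π.ker := by
      refine hJ.prop ?_
      have h1 : ⁅r, k⁆ ∈ (⨅ j ∈ J.erase i, (p j).ker) ⊓ (p i).ker :=
        Subgroup.commutator_le_inf _ _ (Subgroup.commutator_mem_commutator hr hk)
      have h2 : ⁅r, k⁆ ∈ ⨅ j ∈ J.erase i, (p j).ker := h1.1
      simp only [Subgroup.mem_iInf, Finset.mem_erase] at h2 ⊢
      intro j hj
      by_cases hji : j = i
      exacts [hji ▸ h1.2, h2 j ⟨hji, hj⟩]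
    rw [MonoidHom.mem_ker, map_commutatorElement, commutatorElement_eq_one_iff_mul_comm] at hcomm
    exact hcomm
  have hfin (i : I) : (p i).ker.index ≠ 0 := by
    rw [Subgroup.index_ker]; exact Nat.card_pos.ne'
  have hDn : D.Normal := Subgroup.normal_centralizer
  -- the preimage of `D` in `H` centralizes `M`, and its index divides that of `D`
  have hindex : (Subgroup.centralizer (M : Set H)).index ∣ (D.comap π).index := by
    rw [Subgroup.index_comap_of_surjective _ hπ]
    refine dvd_trans (b := (D.comap ι).index) (Subgroup.index_dvd_of_le fun h hh => ?_) ?_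
    · rw [Subgroup.mem_centralizer_iff]
      intro m hm
      have := Subgroup.mem_centralizer_iff.1 hh (ι m) (hMμ (Subgroup.mem_map_of_mem ι hm))
      exact hι (by simpa using this)
    · rw [Subgroup.index_comap]
      exact Subgroup.relIndex_dvd_index_of_normal _ _
  have hmax (i : I) (hi : i ∈ J) (Y : Subgroup F) (hY : Y.Normal) (hYC : Y ≤ D.comap π) :
      Y ≤ (p i).ker ∨ D.comap π ≤ Y ⊔ (p i).ker := by
    have hconj (X : Subgroup F) (hX : X.Normal) : ∀ g ∈ (p i).range, ∀ x ∈ X.map (p i),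
        g * x * g⁻¹ ∈ X.map (p i) := by
      rintro _ ⟨g, rfl⟩ _ ⟨x, hx, rfl⟩
      exact ⟨g * x * g⁻¹, hX.conj_mem x hx g, by simp⟩
    have hrel : ((D.comap π).map (p i)).relIndex (p i).range = (D.comap π).index := by
      rw [MonoidHom.range_eq_map, Subgroup.relIndex_map_map, sup_eq_left.2 (hKC i hi)]
      simp
    rcases hsec (p i).range ((D.comap π).map (p i)) (Y.map (p i)) (Subgroup.map_mono hYC)
      (Subgroup.map_le_range _ _) (hconj _ (hDn.comap π)) (hconj _ hY) (hrel ▸ hindex) with h | h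
    · exact Or.inl ((Subgroup.map_eq_bot_iff Y).1 h)
    · rw [← Subgroup.map_le_map_iff]
      exact Or.inr h.ge
  have hNA : π.ker ≤ μ.comap π := fun x hx => by
    rw [Subgroup.mem_comap, MonoidHom.mem_ker.1 hx]; exact one_mem _
  have hNC : π.ker ≤ D.comap π := fun x hx => by
    rw [Subgroup.mem_comap, MonoidHom.mem_ker.1 hx]; exact one_mem _
  obtain ⟨i, -, h0, hle⟩ := exists_index_le_index J (fun i => (p i).ker) π.ker (μ.comap π)
    (D.comap π) hNA
    (fun h => hμbot (by
      rw [← Subgroup.map_comap_eq_self_of_surjective hπ μ, Subgroup.map_eq_bot_iff]; exact h))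
    hNC
    (fun X hX => (hker_map X hX).imp_right fun h => by
      rw [← Subgroup.comap_map_eq]; exact Subgroup.comap_mono h)
    hJ.prop hKC hfin hmax
  have hcardG : Nat.card G = π.ker.index := by
    rw [Subgroup.index_ker, MonoidHom.range_eq_top.2 hπ]
    simp
  have hGfin : Finite G := Nat.finite_of_card_ne_zero (hcardG ▸ h0)
  refine (hι.bijective_of_nat_card_le ?_).2
  rw [hcardG]
  refine hle.trans ?_
  rw [Subgroup.index_ker]
  exact Subgroup.card_le_card_group _

/-! ### Laws and retractions -/

theorem freeGroup_lift_map {A : Type u} {B : Type v} {K : Type w} [Group K] (f : A → B)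
    (k : B → K) (x : FreeGroup A) :
    FreeGroup.lift k (FreeGroup.map f x) = FreeGroup.lift (k ∘ f) x :=
  DFunLike.congr_fun (FreeGroup.ext_hom ((FreeGroup.lift k).comp (FreeGroup.map f))
    (FreeGroup.lift (k ∘ f)) fun a => by simp) x

/-- A law in letters from a finite alphabet can be rewritten in the letters `ℕ`. -/
theorem InVarietyOf.lift_eq_one {H : Type u} [Group H] {G : Type v} [Group G]
    (hG : InVarietyOf H G) {X : Type w} [Finite X] {x : FreeGroup X}
    (hx : ∀ f : X → H, FreeGroup.lift f x = 1) (g : X → G) : FreeGroup.lift g x = 1 := by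
  obtain ⟨e, he⟩ := Countable.exists_injective_nat X
  have h := hG (FreeGroup.map e x) (fun k => (freeGroup_lift_map e k x).trans (hx _))
    (Function.extend e g 1)
  rwa [freeGroup_lift_map, Function.extend_comp he] at h

theorem IsGroupLaw.map {H : Type u} [Group H] {G : Type v} [Group G] {x : FreeGroup ℕ}
    (hx : IsGroupLaw x H) (f : H →* G) (hf : Function.Surjective f) : IsGroupLaw x G := by
  intro g
  choose s hs using hf
  have h : f.comp (FreeGroup.lift fun n => s (g n)) = FreeGroup.lift g :=
    FreeGroup.ext_hom _ _ fun n => by simp [hs]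
  rw [← h, MonoidHom.comp_apply, hx, map_one]

theorem IsGroupLaw.of_injective {H : Type u} [Group H] {G : Type v} [Group G] {x : FreeGroup ℕ}
    (hx : IsGroupLaw x G) (f : H →* G) (hf : Function.Injective f) : IsGroupLaw x H := by
  intro g
  have h : f.comp (FreeGroup.lift g) = FreeGroup.lift fun n => f (g n) :=
    FreeGroup.ext_hom _ _ fun n => by simp
  exact hf (by rw [← MonoidHom.comp_apply, h, hx, map_one])

theorem isGroupRetract_range_of_leftInverse {H : Type u} [Group H] {G : Type v} [Group G]
    {ι : H →* G} {ρ : G →* H} (h : Function.LeftInverse ρ ι) : IsGroupRetract ι.range := by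
  refine ⟨ι.comp ρ, MonoidHom.ext fun x => by simp [h _], le_antisymm ?_ ?_⟩
  · rintro _ ⟨x, rfl⟩
    exact ⟨ρ x, rfl⟩
  · rintro _ ⟨x, rfl⟩
    exact ⟨ι x, by simp [h _]⟩

theorem IsGroupRetract.exists_leftInverse {H : Type u} [Group H] {G : Type v} [Group G]
    {ι : H →* G} (hι : Function.Injective ι) (h : IsGroupRetract ι.range) :
    ∃ ρ : G →* H, Function.LeftInverse ρ ι := by
  obtain ⟨σ, hσ, hr⟩ := h
  let σ' : G →* ι.range := σ.codRestrict ι.range fun x => hr ▸ ⟨x, rfl⟩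
  refine ⟨(MonoidHom.ofInjective hι).symm.toMonoidHom.comp σ', fun x => ?_⟩
  have hx : σ (ι x) = ι x := by
    obtain ⟨y, hy⟩ : ι x ∈ σ.range := hr ▸ ⟨x, rfl⟩
    rw [← hy, ← MonoidHom.comp_apply, hσ]
  simp only [MonoidHom.comp_apply, MulEquiv.toMonoidHom_eq_coe, MonoidHom.coe_coe]
  rw [MulEquiv.symm_apply_eq]
  exact Subtype.ext hx

theorem IsStrongRetract.of_mulEquiv {H : Type u} [Group H] {K : Type w} [Group K] (e : H ≃* K)
    (hH : IsStrongRetract.{u, v} H) : IsStrongRetract.{w, v} K := by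
  intro G _ ι hι hG
  have h := hH G (ι.comp e.toMonoidHom) (hι.comp e.injective)
    fun x hx => hG x (hx.map e.toMonoidHom e.surjective)
  rwa [MonoidHom.range_comp, MulEquiv.toMonoidHom_eq_coe, MonoidHom.range_eq_top.2 e.surjective,
    ← MonoidHom.range_eq_map] at h

theorem IsStrongRetract.of_subsingleton {H : Type u} [Group H] [Subsingleton H] :
    IsStrongRetract.{u, v} H := fun _ _ _ _ _ =>
  isGroupRetract_range_of_leftInverse (ρ := 1) fun _ => Subsingleton.elim _ _

/-! ### Verbally closed subgroups -/

/-- The verbal subgroup of `G` defined by the laws of `H`. The values of these laws already form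
a subgroup, as two laws can be written in disjoint sets of letters. -/
def verbalSubgroup (H : Type u) [Group H] (G : Type v) [Group G] : Subgroup G where
  carrier := {x | ∃ w : FreeGroup ℕ, IsGroupLaw w H ∧ ∃ g : ℕ → G, FreeGroup.lift g w = x}
  one_mem' := ⟨1, fun _ => map_one _, 1, map_one _⟩
  inv_mem' := by
    rintro _ ⟨w, hw, g, rfl⟩
    exact ⟨w⁻¹, fun h => by rw [map_inv, hw, inv_one], g, map_inv _ _⟩
  mul_mem' := by
    rintro _ _ ⟨w, hw, g, rfl⟩ ⟨w', hw', g', rfl⟩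
    let e := Equiv.natSumNatEquivNat
    refine ⟨FreeGroup.map (e ∘ Sum.inl) w * FreeGroup.map (e ∘ Sum.inr) w',
      fun h => by rw [map_mul, freeGroup_lift_map, freeGroup_lift_map, hw, hw', one_mul],
      Sum.elim g g' ∘ e.symm, ?_⟩
    rw [map_mul, freeGroup_lift_map, freeGroup_lift_map]
    congr 3 <;> ext <;> simp

instance verbalSubgroup_normal (H : Type u) [Group H] (G : Type v) [Group G] :
    (verbalSubgroup H G).Normal where
  conj_mem := by
    rintro _ ⟨w, hw, g, rfl⟩ a
    refine ⟨w, hw, fun n => a * g n * a⁻¹, ?_⟩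
    have h : (MulAut.conj a).toMonoidHom.comp (FreeGroup.lift g) =
        FreeGroup.lift fun n => a * g n * a⁻¹ := FreeGroup.ext_hom _ _ fun n => by simp
    rw [← h]
    simp

theorem inVarietyOf_quotient_verbalSubgroup (H : Type u) [Group H] (G : Type v) [Group G] :
    InVarietyOf H (G ⧸ verbalSubgroup H G) := by
  intro w hw g
  choose s hs using QuotientGroup.mk'_surjective (verbalSubgroup H G)
  have h : (QuotientGroup.mk' (verbalSubgroup H G)).comp (FreeGroup.lift fun n => s (g n)) =
      FreeGroup.lift g := FreeGroup.ext_hom _ _ fun n => by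
    simpa using hs (g n)
  rw [← h, MonoidHom.comp_apply, ← MonoidHom.mem_ker, QuotientGroup.ker_mk']
  exact ⟨w, hw, _, rfl⟩

/-- A retract is algebraically closed: the retraction maps solutions to solutions. -/
theorem isAlgebraicallyClosedSubgroup_of_retraction {G : Type u} [Group G] {K : Subgroup G}
    (r : G →* K) (hr : ∀ k : K, r k = k) : IsAlgebraicallyClosedSubgroup K := by
  rintro S ⟨g, hg⟩
  refine ⟨fun n => r (g n), fun w hw => ?_⟩
  have h : r.comp (Monoid.Coprod.lift K.subtype (FreeGroup.lift g)) =
      Monoid.Coprod.lift (MonoidHom.id K) (FreeGroup.lift fun n => r (g n)) :=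
    Monoid.Coprod.hom_ext (MonoidHom.ext fun k => by simp [hr])
      (FreeGroup.ext_hom _ _ fun n => by simp)
  rw [← h, MonoidHom.comp_apply, hg w hw, map_one]

/-- A verbally closed copy of `H` in `G` meets trivially the verbal subgroup defined by the laws
of `H`, so it embeds into a quotient that lies in the variety of `H`. -/
theorem IsStrongRetract.isStronglyVerballyClosed {H : Type u} [Group H]
    (hH : IsStrongRetract.{u, v} H) : IsStronglyVerballyClosed.{u, v} H := by
  intro G _ ι hι hvc
  let q := QuotientGroup.mk' (verbalSubgroup H G)
  have hinj : Function.Injective (q.comp ι) := by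
    rw [injective_iff_map_eq_one]
    intro x hx
    rw [MonoidHom.comp_apply, ← MonoidHom.mem_ker, QuotientGroup.ker_mk'] at hx
    obtain ⟨w, hw, g, hg⟩ := hx
    obtain ⟨k, hk⟩ := hvc w ⟨ι x, x, rfl⟩ ⟨g, hg⟩
    rw [hw.map ι.rangeRestrict ι.rangeRestrict_surjective] at hk
    exact hι (by simpa using (congrArg Subtype.val hk).symm)
  obtain ⟨ρ, hρ⟩ := (hH _ (q.comp ι) hinj
    (inVarietyOf_quotient_verbalSubgroup H G)).exists_leftInverse hinj
  refine isAlgebraicallyClosedSubgroup_of_retraction (ι.rangeRestrict.comp (ρ.comp q)) ?_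
  rintro ⟨_, x, rfl⟩
  exact Subtype.ext (congrArg ι (hρ x))

/-! ### Strong retracts among finite groups -/

/-- Retractions onto a finite group exist as soon as they exist on the finitely generated
overgroups: an ultrafilter limit glues them together. -/
theorem exists_retraction_of_finset {G : Type v} {H : Type u} [Group G] [Group H] [Finite H]
    (ι : H →* G)
    (h : ∀ S : Finset G, ∃ ρ : (Subgroup.closure (S ∪ Set.range ι)) →* H,
      ∀ x (hx : ι x ∈ Subgroup.closure (S ∪ Set.range ι)), ρ ⟨ι x, hx⟩ = x) :
    ∃ ρ : G →* H, Function.LeftInverse ρ ι := by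
  classical
  choose ρ hρ using h
  let U : Ultrafilter (Finset G) := Ultrafilter.of Filter.atTop
  let r (S : Finset G) (g : G) : H :=
    if hg : g ∈ Subgroup.closure (S ∪ Set.range ι) then ρ S ⟨g, hg⟩ else 1
  have hlim (g : G) : ∃ a : H, ∀ᶠ S in (U : Filter (Finset G)), r S g = a :=
    Ultrafilter.eventually_exists_iff.1 (Filter.Eventually.of_forall fun S => ⟨_, rfl⟩)
  choose f hf using hlim
  have hmem (g : G) : ∀ᶠ S : Finset G in (U : Filter (Finset G)),
      g ∈ Subgroup.closure (S ∪ Set.range ι) := by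
    refine Ultrafilter.of_le _ ((Filter.eventually_ge_atTop {g}).mono fun S hS => ?_)
    exact Subgroup.subset_closure (Or.inl (hS (Finset.mem_singleton_self g)))
  refine ⟨MonoidHom.mk' f fun a b => ?_, fun x => ?_⟩
  · obtain ⟨S, ha, hb, hab, hma, hmb⟩ :=
      ((hf a).and ((hf b).and ((hf (a * b)).and ((hmem a).and (hmem b))))).exists
    rw [← ha, ← hb, ← hab]
    simp only [r, dif_pos hma, dif_pos hmb, dif_pos (mul_mem hma hmb), ← map_mul]
    rfl
  · obtain ⟨S, hx, hmx⟩ := ((hf (ι x)).and (hmem (ι x))).exists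
    change f (ι x) = x
    rw [← hx]
    simp only [r, dif_pos hmx]
    exact hρ S x hmx

/-- A maximal normal subgroup among those that meet the copy of `H` trivially has the
quotient `H`. -/
theorem HasTightMonolith.exists_retraction {F G H I : Type*} [Group F] [Group G] [Group H]
    [Finite H] [Finite I] (hH : HasTightMonolith H) (p : I → F →* H) (π : F →* G)
    (hπ : Function.Surjective π) (hker : ⨅ i, (p i).ker ≤ π.ker) (ι : H →* G)
    (hι : Function.Injective ι) : ∃ ρ : G →* H, Function.LeftInverse ρ ι := by
  obtain ⟨K, -, hK⟩ := zorn_le_nonempty₀ {K : Subgroup G | K.Normal ∧ K ⊓ ι.range = ⊥} (by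
    intro c hc hchain y hy
    have hne : c.Nonempty := ⟨y, hy⟩
    have hmem {x : G} : x ∈ sSup c ↔ ∃ s ∈ c, x ∈ s :=
      Subgroup.mem_sSup_of_directedOn hne hchain.directedOn
    refine ⟨sSup c, ⟨Subgroup.sSup_normal c fun s hs => (hc hs).1, ?_⟩, fun z hz => le_sSup hz⟩
    rw [eq_bot_iff]
    rintro x ⟨hx, hxι⟩
    obtain ⟨s, hs, hxs⟩ := hmem.1 hx
    exact (hc hs).2.le ⟨hxs, hxι⟩) ⊥ ⟨inferInstance, bot_inf_eq _⟩
  have hKn : K.Normal := hK.prop.1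
  let q := QuotientGroup.mk' K
  have hq : Function.Surjective q := QuotientGroup.mk'_surjective K
  have hqk : q.ker = K := QuotientGroup.ker_mk' K
  have hinj : Function.Injective (q.comp ι) := by
    rw [injective_iff_map_eq_one]
    intro x hx
    have h1 : ι x ∈ K ⊓ ι.range := ⟨hqk ▸ hx, x, rfl⟩
    rw [hK.prop.2, Subgroup.mem_bot] at h1
    exact hι (h1.trans ι.map_one.symm)
  have hsurj : Function.Surjective (q.comp ι) := by
    refine hH.surjective_of_essential p (q.comp π) (hq.comp hπ)
      (hker.trans fun x hx => ?_) (q.comp ι) hinj fun X hX hne hX0 => hne ?_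
    · rw [MonoidHom.mem_ker, MonoidHom.comp_apply, MonoidHom.mem_ker.1 hx, map_one]
    · have hle : X.comap q ≤ K := hK.le_of_ge ⟨hX.comap q, by
        rw [eq_bot_iff]
        rintro _ ⟨hx, x, rfl⟩
        have h1 : q (ι x) ∈ X ⊓ (q.comp ι).range := ⟨hx, x, rfl⟩
        rw [hX0, Subgroup.mem_bot] at h1
        rw [Subgroup.mem_bot, hinj (h1.trans (map_one (q.comp ι)).symm), map_one]⟩
        (hqk.symm.le.trans (Subgroup.ker_le_comap q X))
      rw [← Subgroup.map_comap_eq_self_of_surjective hq X, Subgroup.map_eq_bot_iff, hqk]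
      exact hle
  let e := MulEquiv.ofBijective (q.comp ι) ⟨hinj, hsurj⟩
  exact ⟨e.symm.toMonoidHom.comp q, fun x => e.symm_apply_apply x⟩

/-- A finitely generated group in the variety of `H` is a quotient of a free group `F` by a normal
subgroup that contains all words vanishing under the finitely many homomorphisms `F →* H`. -/
theorem HasTightMonolith.isStrongRetract {H : Type u} [Group H] [Finite H]
    (hH : HasTightMonolith H) : IsStrongRetract.{u, v} H := by
  intro G _ ι hι hG
  obtain ⟨ρ, hρ⟩ := exists_retraction_of_finset ι fun S => by
    set L := Subgroup.closure (S ∪ Set.range ι) with hL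
    let X : Set G := S ∪ Set.range ι
    have hX : Finite X := (S.finite_toSet.union (Set.finite_range ι)).to_subtype
    let g : X → L := fun x => ⟨x, Subgroup.subset_closure x.2⟩
    have hsurj : Function.Surjective (FreeGroup.lift g) := by
      rw [← MonoidHom.range_eq_top, FreeGroup.range_lift_eq_closure,
        ← Subgroup.map_injective L.subtype_injective |>.eq_iff, MonoidHom.map_closure,
        ← MonoidHom.range_eq_map, Subgroup.range_subtype]
      have hXL : L.subtype '' Set.range g = X := by
        rw [← Set.range_comp]
        exact Subtype.range_coe
      rw [hXL]
    have hmem (x : H) : ι x ∈ L := Subgroup.subset_closure (Or.inr ⟨x, rfl⟩)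
    have hGL : InVarietyOf H L := fun w hw => (hG w hw).of_injective L.subtype L.subtype_injective
    obtain ⟨ρ, hρ⟩ := hH.exists_retraction (fun f : X → H => FreeGroup.lift f) (FreeGroup.lift g)
      hsurj (fun x hx => hGL.lift_eq_one (fun f => by
        simpa using (Subgroup.mem_iInf.1 hx f)) g) (ι.codRestrict L hmem)
      (fun a b hab => hι (congrArg Subtype.val hab))
    exact ⟨ρ, fun x _ => hρ x⟩
  exact isGroupRetract_range_of_leftInverse hρ

/-! ### The monoliths of symmetric and alternating groups -/

/-- If the centralizer `Z` of the monolith has order at most four and the center is trivial in the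
case of equality, then the sections in question have kernels of order at most four, and order four
occurs only for a normal subgroup of the whole group, where a normal subgroup of order two would be
central. -/
theorem hasTightMonolith_of_card_centralizer {H : Type*} [Group H] [Finite H] (M : Subgroup H)
    (hM : M ≠ ⊥) (hmono : ∀ X : Subgroup H, X.Normal → X ≠ ⊥ → M ≤ X)
    (hZ : Nat.card (Subgroup.centralizer (M : Set H)) ≤ 3 ∨
      Nat.card (Subgroup.centralizer (M : Set H)) ≤ 4 ∧ Subgroup.center H = ⊥) :
    HasTightMonolith H := by
  -- the order of `Q` divides that of `Z`, with a quotient that is a multiple of the index of `P`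
  refine ⟨M, hM, hmono, fun P Q R hRQ hQP _ hR ⟨k, hk⟩ => ?_⟩
  have hQ0 : 0 < Nat.card Q := Nat.card_pos
  set Z := Subgroup.centralizer (M : Set H)
  have hR0 : 0 < Nat.card R := Nat.card_pos
  have hcard : k * Nat.card Q * P.index = Nat.card Z := by
    have h1 : Q.relIndex P * Nat.card Q = Nat.card P := by
      rw [← Subgroup.relIndex_bot_left, ← Subgroup.relIndex_bot_left, mul_comm]
      exact Subgroup.relIndex_mul_relIndex ⊥ Q P bot_le hQP
    have h2 := P.index_mul_card
    have h3 := Z.index_mul_card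
    have h4 : Z.index ≠ 0 := Subgroup.index_ne_zero_of_finite
    apply Nat.eq_of_mul_eq_mul_left (Nat.pos_of_ne_zero h4)
    rw [h3, ← h2, ← h1, hk]
    ring
  have hk0 : k ≠ 0 := by
    rintro rfl
    exact (Nat.card_pos (α := Z)).ne' (by simpa using hcard.symm)
  have hP0 : P.index ≠ 0 := Subgroup.index_ne_zero_of_finite
  obtain ⟨m, hm⟩ := Subgroup.card_dvd_of_le hRQ
  by_cases hR1 : Nat.card R = 1
  · exact Or.inl (Subgroup.card_eq_one.1 hR1)
  by_cases hm1 : m = 1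
  · refine Or.inr (Subgroup.eq_of_le_of_card_ge hRQ ?_)
    rw [hm, hm1, mul_one]
  have hm0 : m ≠ 0 := by rintro rfl; omega
  have hmul : 2 * 2 ≤ Nat.card R * m := Nat.mul_le_mul (by omega) (by omega)
  have hQZ : Nat.card Q ≤ Nat.card Z := by
    rw [← hcard, mul_comm k, mul_assoc]
    exact Nat.le_mul_of_pos_right _ (Nat.mul_pos (Nat.pos_of_ne_zero hk0) (Nat.pos_of_ne_zero hP0))
  rcases hZ with hZ | ⟨hZ, hc⟩
  · omega
  have hQ4 : Nat.card Q = 4 := by omega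
  have hR2 : Nat.card R = 2 := by
    have h1 : Nat.card R ∣ 2 ^ 2 := ⟨m, by omega⟩
    obtain ⟨j, hj, hj'⟩ := (Nat.dvd_prime_pow Nat.prime_two).1 h1
    interval_cases j
    · omega
    · omega
    · have : Nat.card R * m = Nat.card R * 1 := by omega
      exact absurd (Nat.eq_of_mul_eq_mul_left hR0 this) hm1
  have hP1 : P = ⊤ := by
    rw [← Subgroup.index_eq_one]
    have h4 : 4 * (k * P.index) = 4 * 1 := by
      have : Nat.card Z = 4 := by omega
      rw [hQ4, this] at hcard
      rw [← mul_assoc, mul_comm 4 k, hcard]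
    exact Nat.eq_one_of_mul_eq_one_left (Nat.eq_of_mul_eq_mul_left four_pos h4)
  obtain ⟨x, hx1, hx⟩ := (Nat.card_eq_two_iff' (1 : R)).1 hR2
  have hxc : (x : H) ∈ Subgroup.center H := by
    rw [Subgroup.mem_center_iff]
    intro g
    have h := congrArg Subtype.val (hx ⟨g * x * g⁻¹, hR g (hP1 ▸ Subgroup.mem_top g) x x.2⟩
      fun h => hx1 (Subtype.ext (conj_eq_one_iff.1 (congrArg Subtype.val h))))
    exact mul_inv_eq_iff_eq_mul.1 h
  rw [hc, Subgroup.mem_bot] at hxc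
  exact absurd (Subtype.ext hxc) hx1

theorem hasTightMonolith_of_card_le_three {H : Type*} [Group H] [Finite H] [Nontrivial H]
    (h3 : Nat.card H ≤ 3) : HasTightMonolith H := by
  have h1 := Finite.one_lt_card (α := H)
  have : Fact (Nat.card H).Prime := ⟨by
    obtain h | h : Nat.card H = 2 ∨ Nat.card H = 3 := by omega
    · rw [h]; exact Nat.prime_two
    · rw [h]; exact Nat.prime_three⟩
  have : IsSimpleGroup H := isSimpleGroup_of_prime_card rfl
  exact hasTightMonolith_of_card_centralizer ⊤ top_ne_bot
    (fun X hX hne => (hX.eq_bot_or_eq_top.resolve_left hne).ge)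
    (Or.inl ((Subgroup.card_le_card_group _).trans h3))

/-- A group whose smallest nontrivial normal subgroup is not commutative: the centralizer of the
latter is then trivial. -/
theorem hasTightMonolith_of_not_commutative {H : Type*} [Group H] [Finite H] (M : Subgroup H)
    [M.Normal] (hM : ¬ IsMulCommutative M)
    (hmono : ∀ X : Subgroup H, X.Normal → X ≠ ⊥ → M ≤ X) : HasTightMonolith H := by
  have hbot : M ≠ ⊥ := by
    rintro rfl
    exact hM inferInstance
  have hZ : Subgroup.centralizer (M : Set H) = ⊥ := by
    by_contra h
    refine hM ⟨⟨fun a b => Subtype.ext ?_⟩⟩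
    exact (Subgroup.mem_centralizer_iff.1
      (hmono _ Subgroup.normal_centralizer h a.2) b b.2).symm
  exact hasTightMonolith_of_card_centralizer M hbot hmono (Or.inl (by simp [hZ]))

/-- The case of a monolith generated by the conjugates of a single element. -/
theorem hasTightMonolith_of_mem {H : Type*} [Group H] [Finite H] (v : H) (hv : v ≠ 1)
    (hmem : ∀ X : Subgroup H, X.Normal → X ≠ ⊥ → v ∈ X) (s : Finset H)
    (hs : ∀ x : H, (∀ g : H, Commute (g * v * g⁻¹) x) → x ∈ s)
    (hZ : s.card ≤ 3 ∨ s.card ≤ 4 ∧ ∃ g, ¬ Commute g v) : HasTightMonolith H := by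
  have hv' : v ∈ Subgroup.normalClosure {v} := Subgroup.subset_normalClosure rfl
  have hcard : Nat.card (Subgroup.centralizer (Subgroup.normalClosure {v} : Set H)) ≤ s.card := by
    rw [← Nat.card_eq_finsetCard]
    refine Nat.card_mono s.finite_toSet fun x hx => hs x fun g => ?_
    exact Subgroup.mem_centralizer_iff.1 hx _ (Subgroup.normalClosure_normal.conj_mem v hv' g)
  refine hasTightMonolith_of_card_centralizer (Subgroup.normalClosure {v})
    (fun h => hv (by rwa [h, Subgroup.mem_bot] at hv'))
    (fun X hX hne => Subgroup.normalClosure_le_normal (by simpa using hmem X hX hne))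
    (hZ.imp hcard.trans (And.imp hcard.trans ?_))
  rintro ⟨g, hg⟩
  by_contra hne
  exact hg (Subgroup.mem_center_iff.1 (hmem _ inferInstance hne) g)

theorem Subgroup.Normal.commutatorElement_mem {H : Type*} [Group H] {X : Subgroup H} (hX : X.Normal)
    {g : H} (hg : g ∈ X) (a : H) : ⁅g, a⁆ ∈ X := by
  rw [commutatorElement_def, mul_assoc, mul_assoc, ← mul_assoc a]
  exact X.mul_mem hg (hX.conj_mem _ (X.inv_mem hg) a)

/-- The monolith of `Perm (Fin 3)` is generated by a 3-cycle. -/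
theorem hasTightMonolith_perm_fin_three : HasTightMonolith (Equiv.Perm (Fin 3)) := by
  have hcomm : ∀ g : Equiv.Perm (Fin 3), g ≠ 1 →
      ∃ a b : Equiv.Perm (Fin 3), finRotate 3 = ⁅g, a⁆ * ⁅g, b⁆ := by
    decide +kernel
  refine hasTightMonolith_of_mem (finRotate 3) (by decide) (fun X hX hne => ?_)
    {1, finRotate 3, (finRotate 3)⁻¹} (fun x hx => ?_) (Or.inl (by decide))
  · obtain ⟨⟨g, hg⟩, hg1⟩ := Subgroup.ne_bot_iff_exists_ne_one.1 hne
    obtain ⟨a, b, h⟩ := hcomm g fun h => hg1 (Subtype.ext h)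
    exact h ▸ X.mul_mem (hX.commutatorElement_mem hg a) (hX.commutatorElement_mem hg b)
  · have h1 : finRotate 3 * x = x * finRotate 3 := by simpa using (hx 1).eq
    clear hx
    revert x
    decide

/-- The monolith of each of the two subgroups of `Perm (Fin 4)` that contain the alternating group
is generated by the conjugates of a double transposition. It is its own centralizer. -/
theorem hasTightMonolith_of_alternatingGroup_le (L : Subgroup (Equiv.Perm (Fin 4)))
    (hL : alternatingGroup (Fin 4) ≤ L) : HasTightMonolith L := by
  -- all auxiliary permutations are even, so that they lie in `L`
  let c : Equiv.Perm (Fin 4) := Equiv.swap 1 2 * Equiv.swap 2 3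
  let d : Equiv.Perm (Fin 4) := Equiv.swap 0 1 * Equiv.swap 1 2
  let v : Equiv.Perm (Fin 4) := Equiv.swap 0 1 * Equiv.swap 2 3
  let w : Equiv.Perm (Fin 4) := Equiv.swap 0 2 * Equiv.swap 1 3
  have hcomm : ∀ g : Equiv.Perm (Fin 4), g ≠ 1 →
      ∃ a ∈ [c, c⁻¹, v], ∃ b ∈ [c, c⁻¹, d, d⁻¹], v = ⁅⁅g, a⁆, b⁆ := by
    decide +kernel
  have hcent : ∀ x : Equiv.Perm (Fin 4), (∀ g ∈ [1, c], (g * v * g⁻¹) * x = x * (g * v * g⁻¹)) →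
      x ∈ [1, v, w, v * w] := by
    decide +kernel
  have hc : c ∈ L := hL (Equiv.Perm.mem_alternatingGroup.2 (by decide))
  have hd : d ∈ L := hL (Equiv.Perm.mem_alternatingGroup.2 (by decide))
  have hv : v ∈ L := hL (Equiv.Perm.mem_alternatingGroup.2 (by decide))
  have hw : w ∈ L := hL (Equiv.Perm.mem_alternatingGroup.2 (by decide))
  have hAL : ∀ a ∈ [c, c⁻¹, v], a ∈ L := by simp [hc, hv]
  have hBL : ∀ b ∈ [c, c⁻¹, d, d⁻¹], b ∈ L := by simp [hc, hd]
  classical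
  refine hasTightMonolith_of_mem (⟨v, hv⟩ : L) (fun h => ?_) (fun X hX hne => ?_)
    {1, ⟨v, hv⟩, ⟨w, hw⟩, ⟨v, hv⟩ * ⟨w, hw⟩} (fun x hx => ?_)
    (Or.inr ⟨Finset.card_le_four, ⟨c, hc⟩, fun h => ?_⟩)
  · exact absurd (congrArg Subtype.val h) (by decide : v ≠ 1)
  · obtain ⟨⟨g, hgX⟩, hg⟩ := Subgroup.ne_bot_iff_exists_ne_one.1 hne
    obtain ⟨a, ha, b, hb, h⟩ := hcomm g fun h => hg (Subtype.ext (Subtype.ext h))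
    have h2 : ⁅⁅g, (⟨a, hAL a ha⟩ : L)⁆, (⟨b, hBL b hb⟩ : L)⁆ ∈ X :=
      hX.commutatorElement_mem (hX.commutatorElement_mem hgX _) _
    have he : (⟨v, hv⟩ : L) = ⁅⁅g, (⟨a, hAL a ha⟩ : L)⁆, (⟨b, hBL b hb⟩ : L)⁆ := Subtype.ext h
    rwa [he]
  · have h := hcent x fun g hg => congrArg Subtype.val (hx ⟨g, by
      rcases List.mem_pair.1 hg with rfl | rfl
      exacts [one_mem L, hc]⟩).eq
    simp only [List.mem_cons, List.not_mem_nil, or_false] at h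
    simp only [Finset.mem_insert, Finset.mem_singleton, Subtype.ext_iff]
    exact h
  · exact absurd (congrArg Subtype.val h.eq) (by decide : c * v ≠ v * c)

/-! ### Symmetric and alternating groups -/

theorem isStrongRetract_perm (α : Type u) [Fintype α] [DecidableEq α] :
    IsStrongRetract.{u, v} (Equiv.Perm α) := by
  rcases Nat.lt_or_ge (Nat.card α) 5 with h5 | h5
  · let e := (Finite.equivFin α).permCongrHom
    refine IsStrongRetract.of_mulEquiv (e := e.symm) ?_
    generalize Nat.card α = n at h5
    interval_cases n
    · exact .of_subsingleton
    · exact .of_subsingleton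
    · exact (hasTightMonolith_of_card_le_three (by
        rw [Nat.card_perm, Nat.card_fin]; decide)).isStrongRetract
    · exact hasTightMonolith_perm_fin_three.isStrongRetract
    · exact (hasTightMonolith_of_alternatingGroup_le ⊤ le_top).isStrongRetract.of_mulEquiv
        Subgroup.topEquiv
  · refine (hasTightMonolith_of_not_commutative (alternatingGroup α) ?_
      fun X _ hne => ?_).isStrongRetract
    · rw [alternatingGroup.isMulCommutative_iff_card_le_three]
      omega
    · exact Equiv.Perm.alternatingGroup_le_of_normal h5 ((Subgroup.nontrivial_iff_ne_bot X).2 hne)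

theorem isStrongRetract_alternatingGroup (α : Type u) [Fintype α] [DecidableEq α] :
    IsStrongRetract.{u, v} (alternatingGroup α) := by
  rcases Nat.lt_or_ge (Nat.card α) 5 with h5 | h5
  · let e := (Finite.equivFin α).altCongrHom
    refine IsStrongRetract.of_mulEquiv (e := e.symm) ?_
    generalize Nat.card α = n at h5
    interval_cases n
    · exact .of_subsingleton
    · exact .of_subsingleton
    · have : Subsingleton (alternatingGroup (Fin 2)) := by
        rw [alternatingGroup.eq_bot_of_card_le_two (by simp)]
        infer_instance
      exact .of_subsingleton
    · exact (hasTightMonolith_of_card_le_three (by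
        rw [nat_card_alternatingGroup, Nat.card_fin]; decide)).isStrongRetract
    · exact (hasTightMonolith_of_alternatingGroup_le _ le_rfl).isStrongRetract
  · have := alternatingGroup.isSimpleGroup h5
    refine (hasTightMonolith_of_not_commutative ⊤ (fun h => ?_)
      fun X hX hne => (hX.eq_bot_or_eq_top.resolve_left hne).ge).isStrongRetract
    have hc : IsMulCommutative (alternatingGroup α) :=
      ⟨⟨fun a b => congrArg Subtype.val (h.is_comm.comm ⟨a, Subgroup.mem_top a⟩
        ⟨b, Subgroup.mem_top b⟩)⟩⟩
    rw [alternatingGroup.isMulCommutative_iff_card_le_three] at hc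
    omega

theorem mainTheorem1 (α : Type u) [Fintype α] [DecidableEq α] :
    IsStrongRetract.{u, v} (Equiv.Perm α) ∧
      IsStrongRetract.{u, v} (alternatingGroup α) ∧
      IsStronglyVerballyClosed.{u, v} (Equiv.Perm α) ∧
      IsStronglyVerballyClosed.{u, v} (alternatingGroup α) :=
  ⟨isStrongRetract_perm α, isStrongRetract_alternatingGroup α,
    (isStrongRetract_perm α).isStronglyVerballyClosed,
    (isStrongRetract_alternatingGroup α).isStronglyVerballyClosed⟩
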